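/- A Steiner triple system $\mathrm{STS}(v)$ is a set of $v$ points with a collection of 3-subsets (triples) such that every two distinct points lie in exactly one triple. A $k$-bicolouring is a colouring of the points using exactly $k$ colours such that every triple meets exactly two colour classes; it has type $C(n_1,\dots,n_k)$ if $n_1\le\dots\le n_k$ are the sizes of its colour classes. The lower (upper) chromatic number $\chi$ ($\bar\chi$) is the minimum (maximum) $k$ for which a $k$-bicolouring exists. Given an $\mathrm{STS}(v)$ $S=(V,\mathcal B)$ and a 1-factorization $\{F_a : a\in V\}$ of the complete graph on a set $X$ of $v+1$ new points, doubling yields the $\mathrm{STS}(2v+1)$ on $V\cup X$ whose triples are those of $\mathcal B$ and all $\{a,x,y\}$ with $a\in V$, $\{x,y\}\in F_a$. An extended bicolouring of a $k$-bicolouring $\varphi$ of $S$ is a $k$-bicolouring of the doubled system that agrees with $\varphi$ on $V$ and uses the same $k$ colours. Call it a two-colour extension if there are two colours $i\ne j$ whose classes in $V$ have $n_i+n_j=\frac{v+1}{2}$ points in total, this number being even, such that $\frac{v+1}{2}$ of the points of $X$ are coloured $i$ and the other $\frac{v+1}{2}$ are coloured $j$. Theorem 6. There exist: 1. an $\mathrm{STS}(39)$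 with $(\chi,\bar\chi)=(3,4)$, obtained by doubling from an $\mathrm{STS}(19)$ with a 3-bicolouring of type $C(4,6,9)$, and admitting a two-colour extension of that bicolouring; 2. an $\mathrm{STS}(39)$ with $(\chi,\bar\chi)=(4,5)$, obtained by doubling from an $\mathrm{STS}(19)$ with a 4-bicolouring of type $C(1,2,8,8)$, and admitting a two-colour extension of that bicolouring; 3. an $\mathrm{STS}(39)$ with $(\chi,\bar\chi)=(3,5)$, obtained by doubling from an $\mathrm{STS}(19)$ that has both a 3-bicolouring of type $C(4,6,9)$ and a 4-bicolouring of type $C(1,2,8,8)$, and admitting a two-colour extension of the 3-bicolouring of type $C(4,6,9)$. -/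

import Mathlib

/-- A Steiner triple system on the point set `V`: a collection of 3-subsets of `V` such that every
2-subset of `V` is contained in exactly one of them. -/
structure SteinerTripleSystem (V : Type) where
  triples : Set (Finset V)
  card_triple : ∀ B ∈ triples, B.card = 3
  existsUnique_triple : ∀ x y : V, x ≠ y → ∃! B, B ∈ triples ∧ x ∈ B ∧ y ∈ B

/-- A 1-factorization `{F_i : i ∈ I}` of the complete graph on the vertex set `X`: every `F_i` is a
perfect matching, and every edge of the complete graph lies in exactly one `F_i`. -/
structure OneFactorization (I X : Type) where
  factor : I → (⊤ : SimpleGraph X).Subgraph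
  isPerfectMatching : ∀ i, (factor i).IsPerfectMatching
  existsUnique_factor : ∀ x y : X, x ≠ y → ∃! i, (factor i).Adj x y

namespace SteinerTripleSystem

variable {V X : Type}

/-- The triples of the doubling construction: the triples of `S`, and all `{a, x, y}` with `a ∈ V`
and `{x, y}` an edge of the 1-factor associated with `a`. -/
def doublingTriples [DecidableEq V] [DecidableEq X] (S : SteinerTripleSystem V)
    (F : OneFactorization V X) : Set (Finset (V ⊕ X)) :=
  {T | (∃ B ∈ S.triples, T = B.image Sum.inl) ∨
    ∃ (a : V) (x y : X), (F.factor a).Adj x y ∧ T = {Sum.inl a, Sum.inr x, Sum.inr y}}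

/-- The doubling construction: the Steiner triple system on `V ∪ X` (disjoint union) obtained from
a Steiner triple system on `V` and a 1-factorization of the complete graph on `X` whose 1-factors
are indexed by the points of `V`. -/
def doubling [DecidableEq V] [DecidableEq X] (S : SteinerTripleSystem V)
    (F : OneFactorization V X) : SteinerTripleSystem (V ⊕ X) where
  triples := S.doublingTriples F
  card_triple := by
    rintro T (⟨B, hB, rfl⟩ | ⟨a, x, y, h, rfl⟩)
    · rw [Finset.card_image_of_injective _ Sum.inl_injective, S.card_triple B hB]
    · have hxy : x ≠ y := h.ne
      simp [Finset.card_insert_of_notMem, hxy]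
  existsUnique_triple := by
    have mixed : ∀ (a : V) (x : X), ∃! T, T ∈ S.doublingTriples F ∧
        Sum.inl a ∈ T ∧ Sum.inr x ∈ T := by
      intro a x
      obtain ⟨y, hy, hu⟩ := SimpleGraph.Subgraph.isPerfectMatching_iff.1 (F.isPerfectMatching a) x
      refine ⟨{Sum.inl a, Sum.inr x, Sum.inr y}, ⟨Or.inr ⟨a, x, y, hy, rfl⟩, by simp, by simp⟩, ?_⟩
      rintro T ⟨⟨B, hB, rfl⟩ | ⟨b, u, w, h, rfl⟩, h1, h2⟩
      · simp at h2
      · simp only [Finset.mem_insert, Finset.mem_singleton, Sum.inl.injEq, reduceCtorEq,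
          or_false, false_or, Sum.inr.injEq] at h1 h2
        subst h1
        rcases h2 with rfl | rfl
        · rw [hu w h]
        · rw [hu u h.symm, Finset.pair_comm]
    rintro (a | x) (b | y) hne
    · have hab : a ≠ b := fun h => hne (by rw [h])
      obtain ⟨B, ⟨hB, ha, hb⟩, hu⟩ := S.existsUnique_triple a b hab
      refine ⟨B.image Sum.inl, ⟨Or.inl ⟨B, hB, rfl⟩, by simpa using ha, by simpa using hb⟩, ?_⟩
      rintro T ⟨⟨B', hB', rfl⟩ | ⟨c, u, w, h, rfl⟩, h1, h2⟩
      · rw [hu B' ⟨hB', by simpa using h1, by simpa using h2⟩]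
      · simp at h1 h2
        exact absurd (h1.trans h2.symm) hab
    · exact mixed a y
    · obtain ⟨T, ⟨h1, h2, h3⟩, hu⟩ := mixed b x
      exact ⟨T, ⟨h1, h3, h2⟩, fun T' h' => hu T' ⟨h'.1, h'.2.2, h'.2.1⟩⟩
    · have hxy : x ≠ y := fun h => hne (by rw [h])
      obtain ⟨a, ha, hu⟩ := F.existsUnique_factor x y hxy
      refine ⟨{Sum.inl a, Sum.inr x, Sum.inr y}, ⟨Or.inr ⟨a, x, y, ha, rfl⟩, by simp, by simp⟩, ?_⟩
      rintro T ⟨⟨B', hB', rfl⟩ | ⟨c, u, w, h, rfl⟩, h1, h2⟩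
      · simp at h1
      · simp only [Finset.mem_insert, Finset.mem_singleton, reduceCtorEq, false_or,
          Sum.inr.injEq] at h1 h2
        rcases h1 with rfl | rfl <;> rcases h2 with rfl | rfl
        · exact absurd rfl hxy
        · rw [hu c h]
        · rw [hu c h.symm, Finset.pair_comm]
        · exact absurd rfl hxy

/-- A strict `k`-bicolouring: exactly `k` colours are used, and every triple meets exactly two
colour classes. -/
def IsBicolouring (S : SteinerTripleSystem V) {k : ℕ} (φ : V → Fin k) : Prop :=
  Function.Surjective φ ∧ ∀ B ∈ S.triples, (B.image φ).card = 2

/-- `S` admits a strict `k`-bicolouring. -/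
def IsBicolourable (S : SteinerTripleSystem V) (k : ℕ) : Prop :=
  ∃ φ : V → Fin k, S.IsBicolouring φ

/-- The lower chromatic number of `S` exists and equals `m`. -/
def HasLowerChromaticNumber (S : SteinerTripleSystem V) (m : ℕ) : Prop :=
  IsLeast {k | S.IsBicolourable k} m

/-- The upper chromatic number of `S` exists and equals `m`. -/
def HasUpperChromaticNumber (S : SteinerTripleSystem V) (m : ℕ) : Prop :=
  IsGreatest {k | S.IsBicolourable k} m

/-- The number of points in the colour class of `c`. -/
def classSize [Fintype V] {k : ℕ} (φ : V → Fin k) (c : Fin k) : ℕ :=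
  (Finset.univ.filter fun x => φ x = c).card

/-- The multiset of sizes of the colour classes. -/
def colourType [Fintype V] {k : ℕ} (φ : V → Fin k) : Multiset ℕ :=
  (Finset.univ : Finset (Fin k)).val.map (classSize φ)

/-- `φ` is a `k`-bicolouring of `S` of type `C(t)`. -/
def IsBicolouringOfType [Fintype V] (S : SteinerTripleSystem V) {k : ℕ} (φ : V → Fin k)
    (t : Multiset ℕ) : Prop :=
  S.IsBicolouring φ ∧ colourType φ = t

/-- `ψ` is an extended bicolouring, on the system obtained from `S` by the doubling construction
with `F`, of the bicolouring `φ` of `S`: it agrees with `φ` on `V` and uses the same `k` colours. -/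
def IsExtendedBicolouring [DecidableEq V] [DecidableEq X] (S : SteinerTripleSystem V)
    (F : OneFactorization V X) {k : ℕ} (φ : V → Fin k) (ψ : V ⊕ X → Fin k) : Prop :=
  S.IsBicolouring φ ∧ (S.doubling F).IsBicolouring ψ ∧ ∀ a, ψ (Sum.inl a) = φ a

/-- `ψ` is an extended bicolouring of `φ` for which there are two distinct colours `i`, `j` with
`n_i + n_j = (v + 1) / 2`, an even number, such that `(v + 1) / 2` of the new points get the
colour `i` and the other `(v + 1) / 2` new points get the colour `j`. -/
def IsTwoColourExtension [DecidableEq V] [DecidableEq X] [Fintype V] [Fintype X]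
    (S : SteinerTripleSystem V) (F : OneFactorization V X) {k : ℕ}
    (φ : V → Fin k) (ψ : V ⊕ X → Fin k) : Prop :=
  S.IsExtendedBicolouring F φ ψ ∧
  ∃ i j : Fin k, i ≠ j ∧ ∃ m : ℕ, Even m ∧ 2 * m = Fintype.card V + 1 ∧
    classSize φ i + classSize φ j = m ∧
    classSize (fun x : X => ψ (Sum.inr x)) i = m ∧
    classSize (fun x : X => ψ (Sum.inr x)) j = m

end SteinerTripleSystem

/-! ### Steiner triple systems given by lists of blocks -/

/-! A bicolouring of the doubled system gives every triple of `S` exactly two colours on `V`. At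
most one colour is absent from `V`: if `x`, `y` in `X` had two such colours, the triple through them
would meet three classes. So all colour counts of the doubled system lie between the least count for
`S` and the greatest plus one. The upper bound is attained by giving all of `X` one new colour, the
lower by a two-colour extension, which adds no colour (`hasChromaticNumbers_doubling`).

The extension splits `X` into halves coloured `i` and `j`. Ten 1-factors cross between the halves
and belong to the ten points of colours `i`, `j`; the other nine stay inside the halves and belong
to the remaining points (`isTwoColourExtension_halfColouring`).

It remains to exhibit systems of order 19 whose colour counts are {3}, {4} and {3, 4}. Explicit
colourings attain them, and an exhaustive search, proved sound in
`card_image_mem_of_searchColourings`, excludes all others. -/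

/-- The blocks `(a, b, p)` encoded by a list whose `p`-th entry collects the pairs `(a, b)`. -/
def blockList (n : ℕ) (G : List (List (Fin n × Fin n))) : List (Fin n × Fin n × Fin n) :=
  (List.finRange n).flatMap fun (p : Fin n) => (G.getD p.val []).map fun ab => (ab.1, ab.2, p)

/-- The set of points of a block. -/
def blockPoints {n : ℕ} (t : Fin n × Fin n × Fin n) : Finset (Fin n) := {t.1, t.2.1, t.2.2}

/-- `x` is one of the points of the block `t`. -/
def blockMem {n : ℕ} (x : Fin n) (t : Fin n × Fin n × Fin n) : Prop :=
  x = t.1 ∨ x = t.2.1 ∨ x = t.2.2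

instance {n : ℕ} (x : Fin n) (t : Fin n × Fin n × Fin n) : Decidable (blockMem x t) :=
  inferInstanceAs (Decidable (_ ∨ _ ∨ _))

theorem mem_blockPoints {n : ℕ} {x : Fin n} {t : Fin n × Fin n × Fin n} :
    x ∈ blockPoints t ↔ blockMem x t := by
  simp [blockPoints, blockMem]

/-- The Steiner triple system with a given list of blocks. -/
def SteinerTripleSystem.ofBlocks {n : ℕ} (L : List (Fin n × Fin n × Fin n))
    (hL : ∀ t ∈ L, t.1 ≠ t.2.1 ∧ t.1 ≠ t.2.2 ∧ t.2.1 ≠ t.2.2)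
    (hu : ∀ x y : Fin n, x ≠ y →
      (L.filter fun t => decide (blockMem x t ∧ blockMem y t)).length = 1) :
    SteinerTripleSystem (Fin n) where
  triples := {B | ∃ t ∈ L, B = blockPoints t}
  card_triple := by
    rintro B ⟨t, ht, rfl⟩
    obtain ⟨h1, h2, h3⟩ := hL t ht
    exact Finset.card_eq_three.2 ⟨_, _, _, h1, h2, h3, rfl⟩
  existsUnique_triple := by
    intro x y hxy
    obtain ⟨t, ht⟩ := List.length_eq_one_iff.1 (hu x y hxy)
    have key : ∀ s, (s ∈ L ∧ blockMem x s ∧ blockMem y s) ↔ s = t := by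
      intro s
      have := List.mem_singleton (a := s) (b := t)
      rw [← ht, List.mem_filter, decide_eq_true_iff] at this
      exact this
    obtain ⟨h1, h2, h3⟩ := (key t).2 rfl
    refine ⟨blockPoints t, ⟨⟨t, h1, rfl⟩, mem_blockPoints.2 h2, mem_blockPoints.2 h3⟩, ?_⟩
    rintro B ⟨⟨s, hs, rfl⟩, hx, hy⟩
    rw [(key s).1 ⟨hs, mem_blockPoints.1 hx, mem_blockPoints.1 hy⟩]

/-! ### Exhaustive search for bicolourings -/

/-- Exactly two of three colours are distinct. -/
def exactlyTwo (x y z : ℕ) : Bool := if x == y then !(z == x) else z == x || z == y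

/-- Extends the partial colouring `c`, which uses the colours `0, …, m - 1`, to the remaining
points in all ways that give the blocks exactly two colours, where a new colour is always the least
unused one. Returns whether all complete colourings have a number of colours in `K`. -/
def searchColourings {n : ℕ} (K : List ℕ) :
    List (List (Fin n × Fin n)) → List ℕ → ℕ → Bool
  | [], _, m => K.contains m
  -- `g` holds the blocks whose largest point is the one being coloured, so each block is tested as
  -- soon as its three colours are known.
  | g :: G, c, m => (List.range (m + 1)).all fun x =>
      !(g.all fun ab => exactlyTwo (c.getD ab.1 0) (c.getD ab.2 0) x) ||
        searchColourings K G (c ++ [x]) (if x = m then m + 1 else m)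

theorem exactlyTwo_of_card {α : Type*} [DecidableEq α] {e : ℕ → α} {x y z : ℕ} {s : Set ℕ}
    (he : Set.InjOn e s) (hx : x ∈ s) (hy : y ∈ s) (hz : z ∈ s)
    (h : ({e x, e y, e z} : Finset α).card = 2) : exactlyTwo x y z = true := by
  have exy := he.eq_iff hx hy
  have ezx := he.eq_iff hz hx
  have ezy := he.eq_iff hz hy
  unfold exactlyTwo
  by_cases h1 : x = y
  · subst h1
    by_cases h2 : z = x
    · subst h2
      simp at h
    · simp [h2]
  · by_cases h2 : z = x
    · simp [h1, h2]
    · by_cases h3 : z = y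
      · simp [h1, h3]
      · rw [Finset.card_eq_three.2 ⟨e x, e y, e z, mt exy.1 h1, fun h => h2 (ezx.1 h.symm),
          fun h => h3 (ezy.1 h.symm), rfl⟩] at h
        omega

/-- Renaming the values of `f` in order of first appearance turns `f` into one branch of the search.
The map `e` sends the names below `m` back to the values of `f` on the points coloured so far. -/
theorem card_mem_of_searchColourings {n : ℕ} {α : Type*} [DecidableEq α] (K : List ℕ) (f : ℕ → α)
    (G : List (List (Fin n × Fin n))) (c : List ℕ) (m : ℕ) (e : ℕ → α)
    (hG : ∀ i, ∀ ab ∈ G.getD i [], (ab.1 : ℕ) < c.length + i ∧ (ab.2 : ℕ) < c.length + i ∧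
      ({f ab.1, f ab.2, f (c.length + i)} : Finset α).card = 2)
    (he : Set.InjOn e (Set.Iio m))
    (him : (Finset.range m).image e = (Finset.range c.length).image f)
    (hc : ∀ i < c.length, c.getD i 0 < m ∧ e (c.getD i 0) = f i)
    (h : searchColourings K G c m = true) :
    ((Finset.range (c.length + G.length)).image f).card ∈ K := by
  induction G generalizing c m e with
  | nil =>
    rw [List.length_nil, add_zero, ← him, Finset.card_image_of_injOn (by simpa using he)]
    simpa [searchColourings] using h
  | cons g G ih =>
    -- The colour of the next point is old (`x < m`) or new (`x = m`).
    obtain ⟨x, e', hx, hex, hee, hinj, him'⟩ : ∃ (x : ℕ) (e' : ℕ → α), x ≤ m ∧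
        e' x = f c.length ∧ (∀ i < m, e' i = e i) ∧
        Set.InjOn e' (Set.Iio (if x = m then m + 1 else m)) ∧
        (Finset.range (if x = m then m + 1 else m)).image e' =
          (Finset.range (c.length + 1)).image f := by
      by_cases hf : f c.length ∈ (Finset.range c.length).image f
      · have hf' := hf
        rw [← him, Finset.mem_image] at hf'
        obtain ⟨x, hx, hex⟩ := hf'
        have hx := Finset.mem_range.1 hx
        refine ⟨x, e, hx.le, hex, fun _ _ => rfl, ?_, ?_⟩
        · rwa [if_neg hx.ne]
        · rw [if_neg hx.ne, Finset.range_add_one, Finset.image_insert, him,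
            Finset.insert_eq_of_mem hf]
      · have hupd : ∀ i < m, Function.update e m (f c.length) i = e i := fun i hi =>
          Function.update_of_ne hi.ne _ _
        refine ⟨m, Function.update e m (f c.length), le_rfl, by simp, hupd, ?_, ?_⟩
        · have hne : ∀ i < m, e i ≠ f c.length := fun i hi hi' =>
            hf (him ▸ Finset.mem_image.2 ⟨i, Finset.mem_range.2 hi, hi'⟩)
          intro i hi j hj hij
          simp only [if_true, Set.mem_Iio] at hi hj
          rcases Nat.lt_succ_iff_lt_or_eq.1 hi with hi | rfl <;>
            rcases Nat.lt_succ_iff_lt_or_eq.1 hj with hj | rfl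
          · rw [hupd i hi, hupd j hj] at hij
            exact he hi hj hij
          · rw [hupd i hi, Function.update_self] at hij
            exact absurd hij (hne i hi)
          · rw [hupd j hj, Function.update_self] at hij
            exact absurd hij.symm (hne j hj)
          · rfl
        · rw [if_pos rfl, Finset.range_add_one, Finset.range_add_one, Finset.image_insert,
            Finset.image_insert, Function.update_self, ← him]
          congr 1
          exact Finset.image_congr fun i hi => hupd i (by simpa using hi)
    set m' := if x = m then m + 1 else m with hm'
    have hmm : m ≤ m' := by rw [hm']; split_ifs <;> omega
    have hxm : x < m' := by rw [hm']; split_ifs <;> omega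
    have hc' : ∀ i < c.length, c.getD i 0 < m' ∧ e' (c.getD i 0) = f i := fun i hi =>
      ⟨(hc i hi).1.trans_le hmm, by rw [hee _ (hc i hi).1, (hc i hi).2]⟩
    have hall := (List.all_eq_true.1 h) x (List.mem_range.2 (by omega))
    -- The branch of `f` is not pruned, so `hall` yields the recursive call.
    have hg : (g.all fun ab => exactlyTwo (c.getD ab.1 0) (c.getD ab.2 0) x) = true := by
      refine List.all_eq_true.2 fun ab hab => ?_
      obtain ⟨ha, hb, hcard⟩ := hG 0 ab (by simpa using hab)
      rw [add_zero] at ha hb hcard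
      refine exactlyTwo_of_card hinj (hc' _ ha).1 (hc' _ hb).1 hxm ?_
      rw [(hc' _ ha).2, (hc' _ hb).2, hex, hcard]
    rw [hg] at hall
    have hrec := ih (c ++ [x]) m' e' ?_ hinj (by rw [him', List.length_append]; rfl) ?_
      (by simpa using hall)
    · rw [List.length_append, List.length_singleton, add_assoc, add_comm 1] at hrec
      simpa using hrec
    · intro i ab hab
      have := hG (i + 1) ab (by simpa using hab)
      rw [List.length_append, List.length_singleton, add_assoc, add_comm 1]
      exact this
    · intro i hi
      rw [List.length_append, List.length_singleton] at hi
      rcases Nat.lt_succ_iff_lt_or_eq.1 hi with hi | rfl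
      · rw [List.getD_append _ _ _ _ hi]
        exact hc' i hi
      · rw [List.getD_append_right _ _ _ _ le_rfl]
        simpa using ⟨hxm, hex⟩

/-- If the search succeeds, then every map which gives exactly two colours to each block takes a
number of values in `K`. -/
theorem card_image_mem_of_searchColourings {n : ℕ} {K : List ℕ} {G : List (List (Fin n × Fin n))}
    (hlen : G.length = n) (hlt : ∀ t ∈ blockList n G, t.1 < t.2.2 ∧ t.2.1 < t.2.2)
    (hsearch : searchColourings K G [] 0 = true) {α : Type*} [DecidableEq α] (f : Fin n → α)
    (hf : ∀ t ∈ blockList n G, ((blockPoints t).image f).card = 2) :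
    (Finset.univ.image f).card ∈ K := by
  rcases Nat.eq_zero_or_pos n with rfl | hn
  · obtain rfl := List.length_eq_zero_iff.1 hlen
    simpa [searchColourings] using hsearch
  have : NeZero n := ⟨hn.ne'⟩
  -- Only arguments below `n` matter; the reduction modulo `n` just makes `f'` total.
  let f' : ℕ → α := fun i => f (Fin.ofNat n i)
  have hf' : ∀ i : Fin n, f' i = f i := fun i => by simp [f']
  -- No colour is named yet, so any map can serve as `e`.
  have hmem := card_mem_of_searchColourings K f' G [] 0 f' ?_ (by simp) (by simp) (by simp) hsearch
  · convert hmem using 2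
    ext y
    simp only [Finset.mem_image, Finset.mem_univ, true_and, List.length_nil, zero_add,
      Finset.mem_range, hlen]
    constructor
    · rintro ⟨i, rfl⟩
      exact ⟨i, i.2, hf' i⟩
    · rintro ⟨i, hi, rfl⟩
      exact ⟨_, rfl⟩
  · intro i ab hab
    have hi : i < n := by
      by_contra hi
      rw [List.getD_eq_default _ _ (by omega)] at hab
      simp at hab
    have ht : (ab.1, ab.2, (⟨i, hi⟩ : Fin n)) ∈ blockList n G :=
      List.mem_flatMap.2 ⟨⟨i, hi⟩, List.mem_finRange _, List.mem_map.2 ⟨ab, hab, rfl⟩⟩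
    have h1 := hlt _ ht
    have h2 := hf _ ht
    rw [List.length_nil, zero_add, hf', hf', show f' i = f ⟨i, hi⟩ from hf' ⟨i, hi⟩]
    refine ⟨h1.1, h1.2, ?_⟩
    simpa [blockPoints, Finset.image_insert] using h2

/-! ### Chromatic numbers of doubled systems -/

namespace SteinerTripleSystem

variable {V X : Type} [DecidableEq V] [DecidableEq X]

theorem inl_mem_doubling (S : SteinerTripleSystem V) (F : OneFactorization V X)
    {B : Finset V} (hB : B ∈ S.triples) : B.image Sum.inl ∈ (S.doubling F).triples :=
  Or.inl ⟨B, hB, rfl⟩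

theorem IsBicolouring.card_image_inl {S : SteinerTripleSystem V} {F : OneFactorization V X}
    {k : ℕ} {ψ : V ⊕ X → Fin k} (hψ : (S.doubling F).IsBicolouring ψ) {B : Finset V}
    (hB : B ∈ S.triples) : (B.image fun a => ψ (Sum.inl a)).card = 2 := by
  have := hψ.2 _ (S.inl_mem_doubling F hB)
  rwa [Finset.image_image] at this

/-- Any two colours of the doubled system that do not occur on the old points are equal. -/
theorem IsBicolouring.eq_of_notMem_range {S : SteinerTripleSystem V} {F : OneFactorization V X}
    {k : ℕ} {ψ : V ⊕ X → Fin k} (hψ : (S.doubling F).IsBicolouring ψ) {c d : Fin k}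
    (hc : ∀ a, ψ (Sum.inl a) ≠ c) (hd : ∀ a, ψ (Sum.inl a) ≠ d) : c = d := by
  obtain ⟨a | x, rfl⟩ := hψ.1 c
  · exact absurd rfl (hc a)
  obtain ⟨b | y, rfl⟩ := hψ.1 d
  · exact absurd rfl (hd b)
  by_contra hne
  obtain ⟨a, ha, -⟩ := F.existsUnique_factor x y fun h => hne (by rw [h])
  have := hψ.2 _ (Or.inr ⟨a, x, y, ha, rfl⟩)
  rw [Finset.image_insert, Finset.image_insert, Finset.image_singleton,
    Finset.card_eq_three.2 ⟨_, _, _, hc a, hd a, hne, rfl⟩] at this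
  omega

theorem IsBicolouring.le_card_image_inl_add_one [Fintype V] {S : SteinerTripleSystem V}
    {F : OneFactorization V X} {k : ℕ} {ψ : V ⊕ X → Fin k}
    (hψ : (S.doubling F).IsBicolouring ψ) :
    k ≤ (Finset.univ.image fun a => ψ (Sum.inl a)).card + 1 := by
  have h1 : ((Finset.univ.image fun a => ψ (Sum.inl a))ᶜ).card ≤ 1 := by
    refine Finset.card_le_one.2 fun c hc d hd => ?_
    simp only [Finset.mem_compl, Finset.mem_image, Finset.mem_univ, true_and, not_exists] at hc hd
    exact hψ.eq_of_notMem_range hc hd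
  rw [Finset.card_compl, Fintype.card_fin] at h1
  omega

/-- A bicolouring of the old points extends to the doubled system by one new colour. -/
theorem IsBicolourable.doubling_succ [Nonempty X] {S : SteinerTripleSystem V} {k : ℕ}
    (h : S.IsBicolourable k) (F : OneFactorization V X) :
    (S.doubling F).IsBicolourable (k + 1) := by
  obtain ⟨φ, hφ, hB⟩ := h
  refine ⟨Sum.elim (fun a => (φ a).castSucc) fun _ => Fin.last k, ?_, ?_⟩
  · intro c
    induction c using Fin.lastCases with
    | last => exact ⟨Sum.inr (Classical.arbitrary X), rfl⟩
    | cast c =>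
      obtain ⟨a, rfl⟩ := hφ c
      exact ⟨Sum.inl a, rfl⟩
  · rintro T (⟨B, h, rfl⟩ | ⟨a, x, y, -, rfl⟩)
    · rw [Finset.image_image, ← hB B h,
        ← Finset.card_image_of_injective (B.image φ) (Fin.castSucc_injective k), Finset.image_image]
      rfl
    · simp only [Finset.image_insert, Finset.image_singleton, Sum.elim_inl, Sum.elim_inr,
        Finset.pair_eq_singleton]
      exact Finset.card_pair (Fin.castSucc_lt_last _).ne

/-- If all maps which give exactly two colours to each triple of `S` take between `m` and `M`
values, and `S` has an `M`-bicolouring, and the doubled system has an `m`-bicolouring, then the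
chromatic numbers of the doubled system are `m` and `M + 1`. -/
theorem hasChromaticNumbers_doubling [Fintype V] [Nonempty X] {S : SteinerTripleSystem V}
    (F : OneFactorization V X) {m M : ℕ} (hm : (S.doubling F).IsBicolourable m)
    (hM : S.IsBicolourable M)
    (h : ∀ (k : ℕ) (f : V → Fin k), (∀ B ∈ S.triples, (B.image f).card = 2) →
      m ≤ (Finset.univ.image f).card ∧ (Finset.univ.image f).card ≤ M) :
    (S.doubling F).HasLowerChromaticNumber m ∧ (S.doubling F).HasUpperChromaticNumber (M + 1) := by
  refine ⟨⟨hm, ?_⟩, ⟨hM.doubling_succ F, ?_⟩⟩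
  · rintro k ⟨ψ, hψ⟩
    -- The restriction of `ψ` to `V` need not be surjective, so `h` counts values rather than
    -- available colours.
    have h1 := (h k _ fun B hB => hψ.card_image_inl hB).1
    exact h1.trans (by simpa using Finset.card_le_univ (Finset.univ.image fun a => ψ (Sum.inl a)))
  · rintro k ⟨ψ, hψ⟩
    have h1 := (h k _ fun B hB => hψ.card_image_inl hB).2
    exact hψ.le_card_image_inl_add_one.trans (by omega)

end SteinerTripleSystem

/-! ### A 1-factorization of the complete graph on twenty vertices -/

/-- The 1-factorization given by the fixed-point-free involutions `g i`. -/
def OneFactorization.ofInvolutions {I X : Type} (g : I → X → X) (hne : ∀ i x, g i x ≠ x)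
    (hinv : ∀ i x, g i (g i x) = x) (hu : ∀ x y, x ≠ y → ∃! i, g i x = y) :
    OneFactorization I X where
  factor i :=
    { verts := Set.univ
      Adj := fun x y => g i x = y
      adj_sub := by
        rintro x y rfl
        exact (hne i x).symm
      edge_vert := fun _ => trivial
      symm := ⟨by
        rintro x y rfl
        exact hinv i x⟩ }
  isPerfectMatching i :=
    SimpleGraph.Subgraph.isPerfectMatching_iff.2 fun x => 
      ⟨g i x, rfl, fun y (h : g i x = y) => h.symm⟩
  existsUnique_factor := hu

/-- The partner of the vertex `x` in the `i`-th 1-factor. The first ten factors join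
`{0, …, 9}` with `{10, …, 19}`, the last nine consist of 1-factors of each of these two sets. -/
def partner (i : Fin 19) (x : Fin 20) : Fin 20 :=
  -- Partners in opposite halves have positions summing to `i` modulo 10.
  if i.val < 10 then
    if x.val < 10 then Fin.ofNat 20 (10 + (i.val + 10 - x.val) % 10)
    else Fin.ofNat 20 ((i.val + 20 - x.val) % 10)
  else
    let s := i.val - 10
    let r := x.val % 10
    -- Round-robin factors of each half: positions below 9 are joined when their sum is `s` modulo
    -- 9. The solution `5 * s` of `2 * r = s` modulo 9 is joined to 9.
    let y := if r = 9 then s * 5 % 9 else if (s + 9 - r) % 9 = r then 9 else (s + 9 - r) % 9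
    Fin.ofNat 20 (x.val - r + y)

/-- A 1-factorization of `K₂₀` that splits into a 1-factorization of `K₁₀,₁₀` (the first ten
factors) and one of `2K₁₀`. -/
def splitFactorization : OneFactorization (Fin 19) (Fin 20) :=
  .ofInvolutions partner (by decide +kernel) (by decide +kernel) (by
    have h : ∀ x y : Fin 20, x ≠ y → ∃ i, partner i x = y ∧ ∀ j, partner j x = y → j = i := by
      decide +kernel
    exact h)

/-- The colouring of the new points by `i` on the first half and `j` on the second half. -/
def halfColouring {k : ℕ} (i j : Fin k) (x : Fin 20) : Fin k := if x.val < 10 then i else j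

theorem halfColouring_eq_left {k : ℕ} {i j : Fin k} (hij : i ≠ j) {x : Fin 20} :
    halfColouring i j x = i ↔ x.val < 10 := by
  unfold halfColouring
  split_ifs with h <;> simp [h, hij.symm]

theorem halfColouring_eq_right {k : ℕ} {i j : Fin k} (hij : i ≠ j) {x : Fin 20} :
    halfColouring i j x = j ↔ ¬ x.val < 10 := by
  unfold halfColouring
  split_ifs with h <;> simp [h, hij]

theorem partner_cross : ∀ (a : Fin 19) (x : Fin 20), a.val < 10 →
    ((partner a x).val < 10 ↔ ¬ x.val < 10) := by
  decide +kernel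

theorem partner_same : ∀ (a : Fin 19) (x : Fin 20), ¬ a.val < 10 →
    ((partner a x).val < 10 ↔ x.val < 10) := by
  decide +kernel

/-- A crossing edge has colours `i` and `j`, one of which its old point repeats; an edge inside a
half has one colour, which its old point avoids. -/
theorem card_halfColouring_partner {k : ℕ} {φ : Fin 19 → Fin k} {i j : Fin k} (hij : i ≠ j)
    (hold : ∀ a : Fin 19, (φ a = i ∨ φ a = j) ↔ a.val < 10) (a : Fin 19) (x : Fin 20) :
    ({φ a, halfColouring i j x, halfColouring i j (partner a x)} : Finset (Fin k)).card = 2 := by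
  by_cases ha : a.val < 10
  · have hp := partner_cross a x ha
    by_cases hx : x.val < 10 <;> rcases (hold a).2 ha with h | h <;>
      simp [halfColouring, h, hx, hp, hij, hij.symm]
  · have hp := partner_same a x ha
    have h := mt (hold a).1 ha
    rw [not_or] at h
    by_cases hx : x.val < 10 <;> simp [halfColouring, h, hx, hp]

/-- If the points of colours `i` and `j` are the first ten, then colouring the two halves of the
new points by `i` and `j` is a two-colour extension. -/
theorem isTwoColourExtension_halfColouring {S : SteinerTripleSystem (Fin 19)} {k : ℕ}
    {φ : Fin 19 → Fin k} (hφ : S.IsBicolouring φ) {i j : Fin k} (hij : i ≠ j)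
    (hold : ∀ a : Fin 19, (φ a = i ∨ φ a = j) ↔ a.val < 10) :
    S.IsTwoColourExtension splitFactorization φ (Sum.elim φ (halfColouring i j)) := by
  refine ⟨⟨hφ, ⟨fun c => ?_, ?_⟩, fun _ => rfl⟩, i, j, hij, 10, by decide, by simp, ?_, ?_, ?_⟩
  · obtain ⟨a, rfl⟩ := hφ.1 c
    exact ⟨Sum.inl a, rfl⟩
  · rintro T (⟨B, hB, rfl⟩ | ⟨a, x, y, h, rfl⟩)
    · rw [Finset.image_image]
      exact hφ.2 B hB
    · obtain rfl : partner a x = y := h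
      simpa [Finset.image_insert] using card_halfColouring_partner hij hold a x
  · have hd : Disjoint (Finset.univ.filter fun a => φ a = i) (Finset.univ.filter fun a => φ a = j) :=
      Finset.disjoint_filter.2 fun a _ h1 h2 => hij (h1.symm.trans h2)
    rw [SteinerTripleSystem.classSize, SteinerTripleSystem.classSize,
      ← Finset.card_union_of_disjoint hd, ← Finset.filter_or, Finset.filter_congr fun a _ => hold a]
    decide
  · simp only [SteinerTripleSystem.classSize, Sum.elim_inr, halfColouring_eq_left hij]
    decide
  · simp only [SteinerTripleSystem.classSize, Sum.elim_inr, halfColouring_eq_right hij]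
    decide

/-! ### The three systems of order nineteen -/

/-- The decidable conditions for a list to encode the blocks of a Steiner triple system, each
ordered so that its largest point comes last. -/
def EncodesSystem {n : ℕ} (G : List (List (Fin n × Fin n))) : Prop :=
  G.length = n ∧
    ((blockList n G).all fun t => Nat.blt t.1 t.2.1 && Nat.blt t.2.1 t.2.2) = true ∧
    ∀ x y : Fin n, x ≠ y →
      ((blockList n G).filter fun t => decide (blockMem x t ∧ blockMem y t)).length = 1

instance {n : ℕ} (G : List (List (Fin n × Fin n))) : Decidable (EncodesSystem G) :=
  inferInstanceAs (Decidable (_ ∧ _ ∧ _))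

theorem EncodesSystem.lt {n : ℕ} {G : List (List (Fin n × Fin n))} (h : EncodesSystem G)
    {t : Fin n × Fin n × Fin n} (ht : t ∈ blockList n G) : t.1 < t.2.1 ∧ t.2.1 < t.2.2 := by
  simpa using List.all_eq_true.1 h.2.1 t ht

/-- The Steiner triple system encoded by a list. -/
def EncodesSystem.system {n : ℕ} {G : List (List (Fin n × Fin n))} (h : EncodesSystem G) :
    SteinerTripleSystem (Fin n) :=
  .ofBlocks (blockList n G)
    (fun _ ht => ⟨(h.lt ht).1.ne, ((h.lt ht).1.trans (h.lt ht).2).ne, (h.lt ht).2.ne⟩)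
    h.2.2

theorem card_eq_two_of_exactlyTwo {k : ℕ} {x y z : Fin k} (h : exactlyTwo x y z = true) :
    ({x, y, z} : Finset (Fin k)).card = 2 := by
  rcases eq_or_ne x y with rfl | hxy
  · have hz : x ≠ z := fun hz => by simp [exactlyTwo, hz] at h
    simp [hz]
  · have hz : z = x ∨ z = y := by simpa [exactlyTwo, Fin.val_inj, hxy] using h
    rcases hz with rfl | rfl <;> simp [hxy, hxy.symm]

theorem EncodesSystem.isBicolouring {n k : ℕ} {G : List (List (Fin n × Fin n))}
    (h : EncodesSystem G) {φ : Fin n → Fin k} (hφ : ∀ c, ∃ a, φ a = c)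
    (hB : ((blockList n G).all fun t => exactlyTwo (φ t.1) (φ t.2.1) (φ t.2.2)) = true) :
    h.system.IsBicolouring φ := by
  refine ⟨hφ, ?_⟩
  rintro B ⟨t, ht, rfl⟩
  rw [blockPoints, Finset.image_insert, Finset.image_insert, Finset.image_singleton]
  exact card_eq_two_of_exactlyTwo (List.all_eq_true.1 hB t ht)

theorem EncodesSystem.card_image_mem {n : ℕ} {G : List (List (Fin n × Fin n))}
    (h : EncodesSystem G) {K : List ℕ} (hK : searchColourings K G [] 0 = true) {α : Type*}
    [DecidableEq α] (f : Fin n → α) (hf : ∀ B ∈ h.system.triples, (B.image f).card = 2) :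
    (Finset.univ.image f).card ∈ K :=
  card_image_mem_of_searchColourings h.1
    (fun _ ht => ⟨(h.lt ht).1.trans (h.lt ht).2, (h.lt ht).2⟩) hK f
    fun t ht => hf _ ⟨t, ht, rfl⟩

/-- The colouring given by a list of colours. -/
def listColouring {n k : ℕ} [NeZero k] (l : List (Fin k)) (a : Fin n) : Fin k := l.getD a.val 0

/-- The blocks of a system all of whose bicolourings have three colours. -/
def blocksThree : List (List (Fin 19 × Fin 19)) :=
  [[], [], [(0, 1)], [], [(1, 3)], [(2, 3)], [(0, 3), (4, 5)], [(1, 5), (2, 6)], [(0, 5), (4, 7)],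
    [(1, 6), (2, 8), (3, 7)], [(0, 9)], [(2, 10), (5, 9)], [(3, 11), (6, 8), (7, 10)], [(0, 11),
    (3, 8), (4, 10), (5, 12)], [(0, 7), (1, 13), (4, 12), (6, 11), (8, 10)], [(1, 12), (2, 4), (3,
    10), (6, 13), (7, 11), (9, 14)], [(0, 15), (1, 8), (2, 12), (4, 11), (5, 14), (6, 10), (9,
    13)], [(0, 12), (1, 11), (2, 14), (3, 16), (4, 9), (5, 10), (7, 13), (8, 15)], [(0, 4), (1,
    10), (2, 13), (3, 14), (5, 15), (6, 17), (7, 16), (8, 11), (9, 12)]]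

/-- The blocks of a system all of whose bicolourings have four colours. -/
def blocksFour : List (List (Fin 19 × Fin 19)) :=
  [[], [], [(0, 1)], [], [(2, 3)], [(1, 4)], [(3, 5)], [(0, 5)], [(2, 6)], [(2, 7), (5, 8)], [(0,
    9), (1, 6), (2, 5), (3, 7), (4, 8)], [(1, 7), (6, 9)], [(0, 4), (2, 11), (7, 8)], [(0, 8), (1,
    3), (4, 11), (9, 12)], [(3, 9), (4, 7), (5, 11), (6, 12), (10, 13)], [(0, 14), (1, 8), (3,
    11), (4, 9), (5, 12), (6, 13)], [(0, 6), (1, 9), (2, 14), (3, 12), (7, 13), (8, 11), (10,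
    15)], [(0, 3), (1, 12), (2, 15), (4, 16), (5, 13), (6, 7), (8, 14), (10, 11)], [(0, 11), (1,
    14), (2, 13), (3, 8), (4, 6), (5, 16), (7, 15), (9, 17), (10, 12)]]

/-- The blocks of a system with 3-bicolourings and 4-bicolourings. -/
def blocksThreeFour : List (List (Fin 19 × Fin 19)) :=
  [[], [], [(0, 1)], [], [(1, 3)], [(2, 3)], [(0, 5), (2, 4)], [(0, 3), (1, 6)], [(0, 4), (5, 7)],
    [(1, 5), (2, 8), (4, 7)], [(3, 6)], [(0, 9), (7, 10)], [(1, 10), (2, 7), (3, 11)], [(0, 12),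
    (4, 5), (8, 11), (9, 10)], [(1, 11), (3, 13), (4, 10), (6, 9), (8, 12)], [(2, 14), (3, 8), (4,
    12), (5, 10), (6, 11), (7, 13)], [(0, 10), (1, 8), (2, 13), (5, 11), (6, 12), (7, 14), (9,
    15)], [(0, 15), (1, 13), (2, 10), (3, 16), (4, 11), (5, 14), (6, 8), (9, 12)], [(0, 14), (1,
    15), (2, 11), (3, 9), (4, 16), (5, 12), (6, 13), (7, 17), (8, 10)]]

/-- A 3-bicolouring of the system of `blocksThree`. -/
def colouringThree : Fin 19 → Fin 3 :=
  listColouring [1, 0, 1, 0, 1, 1, 0, 1, 0, 1, 2, 2, 2, 2, 2, 2, 2, 2, 2]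

/-- A 4-bicolouring of the system of `blocksFour`. -/
def colouringFour : Fin 19 → Fin 4 :=
  listColouring [1, 1, 0, 1, 1, 0, 1, 1, 1, 1, 2, 3, 3, 3, 3, 3, 3, 3, 3]

/-- A 3-bicolouring of the system of `blocksThreeFour`. -/
def colouringThreeFour₃ : Fin 19 → Fin 3 :=
  listColouring [1, 1, 0, 1, 0, 0, 1, 0, 1, 1, 2, 2, 2, 2, 2, 2, 2, 2, 2]

/-- A 4-bicolouring of the system of `blocksThreeFour`. -/
def colouringThreeFour₄ : Fin 19 → Fin 4 :=
  listColouring [2, 1, 2, 3, 3, 3, 2, 2, 3, 3, 3, 2, 3, 2, 2, 1, 3, 2, 0]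

/-! ### Verification of the three systems and their colourings -/

set_option maxRecDepth 100000 in
theorem encodesSystem_blocksThree : EncodesSystem blocksThree := by
  decide +kernel

theorem searchColourings_blocksThree : searchColourings [3] blocksThree [] 0 = true := by
  decide +kernel

set_option maxRecDepth 100000 in
theorem isBicolouringOfType_colouringThree :
    encodesSystem_blocksThree.system.IsBicolouringOfType colouringThree {4, 6, 9} :=
  ⟨encodesSystem_blocksThree.isBicolouring (by decide +kernel) (by decide +kernel),
    by decide +kernel⟩

set_option maxRecDepth 100000 in
theorem encodesSystem_blocksFour : EncodesSystem blocksFour := by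
  decide +kernel

theorem searchColourings_blocksFour : searchColourings [4] blocksFour [] 0 = true := by
  decide +kernel

set_option maxRecDepth 100000 in
theorem isBicolouringOfType_colouringFour :
    encodesSystem_blocksFour.system.IsBicolouringOfType colouringFour {1, 2, 8, 8} :=
  ⟨encodesSystem_blocksFour.isBicolouring (by decide +kernel) (by decide +kernel),
    by decide +kernel⟩

set_option maxRecDepth 100000 in
theorem encodesSystem_blocksThreeFour : EncodesSystem blocksThreeFour := by
  decide +kernel

theorem searchColourings_blocksThreeFour : searchColourings [3, 4] blocksThreeFour [] 0 = true := by
  decide +kernel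

set_option maxRecDepth 100000 in
theorem isBicolouringOfType_colouringThreeFour₃ :
    encodesSystem_blocksThreeFour.system.IsBicolouringOfType colouringThreeFour₃ {4, 6, 9} :=
  ⟨encodesSystem_blocksThreeFour.isBicolouring (by decide +kernel) (by decide +kernel),
    by decide +kernel⟩

set_option maxRecDepth 100000 in
theorem isBicolouringOfType_colouringThreeFour₄ :
    encodesSystem_blocksThreeFour.system.IsBicolouringOfType colouringThreeFour₄ {1, 2, 8, 8} :=
  ⟨encodesSystem_blocksThreeFour.isBicolouring (by decide +kernel) (by decide +kernel),
    by decide +kernel⟩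

theorem chromaticNumbers_of_searchColourings {G : List (List (Fin 19 × Fin 19))}
    (hG : EncodesSystem G) {K : List ℕ} (hK : searchColourings K G [] 0 = true) {m M : ℕ}
    (hm : ∀ k ∈ K, m ≤ k ∧ k ≤ M) {φ : Fin 19 → Fin m} {ψ : Fin 19 ⊕ Fin 20 → Fin m}
    (hψ : hG.system.IsTwoColourExtension splitFactorization φ ψ) (hM : hG.system.IsBicolourable M) :
    (hG.system.doubling splitFactorization).HasLowerChromaticNumber m ∧
      (hG.system.doubling splitFactorization).HasUpperChromaticNumber (M + 1) :=
  SteinerTripleSystem.hasChromaticNumbers_doubling _ ⟨ψ, hψ.1.2.1⟩ hM fun _ f hf =>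
    hm _ (hG.card_image_mem hK f hf)

theorem theorem6 :
    (∃ (S : SteinerTripleSystem (Fin 19)) (F : OneFactorization (Fin 19) (Fin 20))
        (φ : Fin 19 → Fin 3) (ψ : Fin 19 ⊕ Fin 20 → Fin 3),
      S.IsBicolouringOfType φ {4, 6, 9} ∧ S.IsTwoColourExtension F φ ψ ∧
      (S.doubling F).HasLowerChromaticNumber 3 ∧ (S.doubling F).HasUpperChromaticNumber 4) ∧
    (∃ (S : SteinerTripleSystem (Fin 19)) (F : OneFactorization (Fin 19) (Fin 20))
        (φ : Fin 19 → Fin 4) (ψ : Fin 19 ⊕ Fin 20 → Fin 4),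
      S.IsBicolouringOfType φ {1, 2, 8, 8} ∧ S.IsTwoColourExtension F φ ψ ∧
      (S.doubling F).HasLowerChromaticNumber 4 ∧ (S.doubling F).HasUpperChromaticNumber 5) ∧
    (∃ (S : SteinerTripleSystem (Fin 19)) (F : OneFactorization (Fin 19) (Fin 20))
        (φ : Fin 19 → Fin 3) (ψ : Fin 19 ⊕ Fin 20 → Fin 3),
      S.IsBicolouringOfType φ {4, 6, 9} ∧ S.IsTwoColourExtension F φ ψ ∧
      (∃ φ' : Fin 19 → Fin 4, S.IsBicolouringOfType φ' {1, 2, 8, 8}) ∧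
      (S.doubling F).HasLowerChromaticNumber 3 ∧ (S.doubling F).HasUpperChromaticNumber 5) := by
  have h1 := isBicolouringOfType_colouringThree
  have h2 := isBicolouringOfType_colouringFour
  have h3 := isBicolouringOfType_colouringThreeFour₃
  have h4 := isBicolouringOfType_colouringThreeFour₄
  have e1 := isTwoColourExtension_halfColouring h1.1 (i := 0) (j := 1) (by decide)
    (by decide +kernel)
  -- Here the first ten points form the class of size 2 and one class of size 8; in the other two
  -- cases they form the classes of sizes 4 and 6.
  have e2 := isTwoColourExtension_halfColouring h2.1 (i := 0) (j := 1) (by decide)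
    (by decide +kernel)
  have e3 := isTwoColourExtension_halfColouring h3.1 (i := 0) (j := 1) (by decide)
    (by decide +kernel)
  exact ⟨⟨_, _, _, _, h1, e1, chromaticNumbers_of_searchColourings _
      searchColourings_blocksThree (by decide) e1 ⟨_, h1.1⟩⟩,
    ⟨_, _, _, _, h2, e2, chromaticNumbers_of_searchColourings _
      searchColourings_blocksFour (by decide) e2 ⟨_, h2.1⟩⟩,
    -- The lower number comes from the extended 3-bicolouring, the upper from the 4-bicolouring with
    -- one new colour on `X`.
    ⟨_, _, _, _, h3, e3, ⟨_, h4⟩, chromaticNumbers_of_searchColourings _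
      searchColourings_blocksThreeFour (by decide) e3 ⟨_, h4.1⟩⟩⟩
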